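/- Let $A_1,\dots,A_N$ be bounded skew-adjoint operators on a (real or complex) Hilbert space and let $a_1,\dots,a_N$ be real numbers with $\|A_j\|\le a_j$ (in particular $a_j=\|A_j\|$ is allowed). Put $$\chi(h)=e^{hA_1}e^{hA_2}\cdots e^{hA_N},\qquad \chi^*(h)=e^{hA_N}\cdots e^{hA_2}e^{hA_1},\qquad S_2(h)=\chi(h/2)\,\chi^*(h/2),$$ and, for $h\ge 0$, $\lambda=h(a_1+\cdots+a_N)$. A family $\Psi(h)$ is said to be of order $p$ if $\Psi(h)-e^{h(A_1+\cdots+A_N)}=\mathcal O(h^{p+1})$ as $h\to0$. For real numbers $\alpha_1,\alpha_2,\dots$ and positive integers $i_1,\dots,i_m$, the coefficients $w_{i_1,\dots,i_m}$ are defined recursively by $$w_{i_1,\dots,i_m}(\alpha_1,\dots,\alpha_{2\ell})=\sum_{j=1}^{\ell}\bigl(\alpha_{2j}^{\,i_m}-(-\alpha_{2j-1})^{i_m}\bigr)\,w_{i_1,\dots,i_{m-1}}(\alpha_1,\dots,\alpha_{2j-1}),$$ $$w_{i_1,\dots,i_m}(\alpha_1,\dots,\alpha_{2\ell-1})=w_{i_1,\dots,i_m}(\alpha_1,\dots,\alpha_{2\ell-1},0),$$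 where $w=1$ for the empty multi-index ($m=0$). Let $\epsilon_{i_1,\dots,i_m}=1/m!$ if $i_1=\cdots=i_m=1$ and $\epsilon_{i_1,\dots,i_m}=0$ otherwise. For $m\ge1$ let $$v_{i_1,\dots,i_m}=w_{i_1,\dots,i_m}+\bigl(-\tfrac12\bigr)^{i_1+\cdots+i_m}\epsilon_{i_1,\dots,i_m}+\sum_{j=1}^{m-1}\bigl(-\tfrac12\bigr)^{i_1+\cdots+i_j}\epsilon_{i_1,\dots,i_j}\,w_{i_{j+1},\dots,i_m},$$ all $w$ and $v$ being evaluated at $(\alpha_1,\dots,\alpha_s)$. Finally, let $$d_n^{\mathrm{sym}}(\alpha_1,\dots,\alpha_s)=2\sum_{m\ge1}\ \sum_{i_1+\cdots+i_m=n}\frac{|v_{i_1,\dots,i_m}(\alpha_1,\dots,\alpha_s)|}{i_1!\cdots i_m!}\quad(n\text{ odd}),\qquad d_n^{\mathrm{sym}}(\alpha_1,\dots,\alpha_s)=0\quad(n\text{ even}),$$ the inner sum being over positive integers $i_1,\dots,i_m$. Let $p$ be even and $q\ge p$. (a) Let $(\alpha_1,\dots,\alpha_{2s})\in\mathbb R^{2s}$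 satisfy $\alpha_{2s+1-j}=\alpha_j$ for $1\le j\le 2s$, and suppose that $\Psi(h)=\chi(\alpha_{2s}h)\,\chi^*(\alpha_{2s-1}h)\cdots\chi(\alpha_2h)\,\chi^*(\alpha_1h)$ is of order $p$. Then, for all $h\ge0$, $$\Bigl\|\Psi(h)-e^{h\sum_{j=1}^N A_j}\Bigr\|\le\sum_{n=p+1}^{q}d_n^{\mathrm{sym}}(\alpha_1,\dots,\alpha_s)\,\lambda^n+\frac{\lambda^{q+1}}{(q+1)!\,2^q}\Bigl(1+2\sum_{i=1}^s|\alpha_i|\Bigr)^{q+1}.$$ (b) Let $(\gamma_1,\dots,\gamma_s)\in\mathbb R^{s}$ satisfy $\gamma_{s+1-i}=\gamma_i$ for $1\le i\le s$, and suppose that $\Psi(h)=S_2(\gamma_sh)\cdots S_2(\gamma_2h)\,S_2(\gamma_1h)$ is of order $p$. Let $(\alpha_1,\dots,\alpha_{2s})=\bigl(\tfrac{\gamma_1}2,\tfrac{\gamma_1}2,\dots,\tfrac{\gamma_s}2,\tfrac{\gamma_s}2\bigr)$. Then, for all $h\ge0$, $$\Bigl\|\Psi(h)-e^{h\sum_{j=1}^N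 A_j}\Bigr\|\le\sum_{n=p+1}^{q}d_n^{\mathrm{sym}}(\alpha_1,\dots,\alpha_s)\,\lambda^n+\frac{\lambda^{q+1}}{(q+1)!\,2^q}\Bigl(1+\sum_{i=1}^s|\gamma_i|\Bigr)^{q+1}.$$ -/

import Mathlib

open Asymptotics Topology

noncomputable section

namespace SplittingError

section Schemes

variable {𝕜 H : Type*} [RCLike 𝕜] [NormedAddCommGroup H] [InnerProductSpace 𝕜 H]
  [CompleteSpace H] {N : ℕ}

/-- The exponential `e^{t B}` of a bounded operator, for a real time `t`. -/
def expTime (B : H →L[𝕜] H) (t : ℝ) : H →L[𝕜] H :=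
  NormedSpace.exp ((t : 𝕜) • B)

/-- The basic scheme `χ(h) = e^{h A₁} e^{h A₂} ⋯ e^{h A_N}`. -/
def chi (A : Fin N → H →L[𝕜] H) (h : ℝ) : H →L[𝕜] H :=
  (List.ofFn fun j => expTime (A j) h).prod

/-- The adjoint scheme `χ*(h) = e^{h A_N} ⋯ e^{h A₂} e^{h A₁}`. -/
def chiStar (A : Fin N → H →L[𝕜] H) (h : ℝ) : H →L[𝕜] H :=
  (List.ofFn fun j => expTime (A j) h).reverse.prod

/-- The `k`-fold alternating composition `⋯ χ(α₂ h) χ*(α₁ h)`: the factor with coefficient `α_i`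
is `χ*` for odd `i` and `χ` for even `i`. Only the values `α 1, …, α k` are used. For `k = 2s`
this is `χ(α_{2s} h) χ*(α_{2s-1} h) ⋯ χ(α₂ h) χ*(α₁ h)`. -/
def composition (A : Fin N → H →L[𝕜] H) (α : ℕ → ℝ) (h : ℝ) : ℕ → H →L[𝕜] H
  | 0 => 1
  | k + 1 =>
    (if Even (k + 1) then chi A (α (k + 1) * h) else chiStar A (α (k + 1) * h)) *
      composition A α h k

/-- The Strang splitting `S₂(h) = χ(h/2) χ*(h/2)`. -/
def strang (A : Fin N → H →L[𝕜] H) (h : ℝ) : H →L[𝕜] H :=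
  chi A (h / 2) * chiStar A (h / 2)

/-- The `k`-stage composition `S₂(γ_k h) ⋯ S₂(γ₂ h) S₂(γ₁ h)`. Only the values `γ 1, …, γ k`
are used. -/
def strangComposition (A : Fin N → H →L[𝕜] H) (γ : ℕ → ℝ) (h : ℝ) : ℕ → H →L[𝕜] H
  | 0 => 1
  | k + 1 => strang A (γ (k + 1) * h) * strangComposition A γ h k

/-- `Ψ(h)` approximates `e^{h (A₁ + ⋯ + A_N)}` with order `p`:
`Ψ(h) - e^{h (A₁ + ⋯ + A_N)} = O(h^{p+1})` as `h → 0`. -/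
def HasOrder (A : Fin N → H →L[𝕜] H) (Ψ : ℝ → H →L[𝕜] H) (p : ℕ) : Prop :=
  (fun h : ℝ => Ψ h - expTime (∑ j, A j) h) =O[𝓝 0] fun h : ℝ => h ^ (p + 1)

end Schemes

/-- A tuple `(c₁, …, c_k)`, stored as the values `c 1, …, c k`, is palindromic. -/
def IsPalindromic (c : ℕ → ℝ) (k : ℕ) : Prop :=
  ∀ j, 1 ≤ j → j ≤ k → c (k + 1 - j) = c j

/-- The coefficients `w` with the multi-index listed from its last entry: `wRev α k [i_m, …, i₁]`
is `w_{i₁,…,i_m}(α₁, …, α_k)`. For `k = 2ℓ` it is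
`∑_{j=1}^ℓ (α_{2j}^{i_m} - (-α_{2j-1})^{i_m}) w_{i₁,…,i_{m-1}}(α₁, …, α_{2j-1})`, and for odd `k`
the missing entry `α_{k+1}` is replaced by `0`. The coefficient of the empty multi-index is `1`. -/
def wRev (α : ℕ → ℝ) : ℕ → List ℕ → ℝ
  | _, [] => 1
  | k, i :: I =>
    ∑ j ∈ Finset.Icc 1 ((k + 1) / 2),
      ((if 2 * j ≤ k then α (2 * j) else 0) ^ i - (-α (2 * j - 1)) ^ i) * wRev α (2 * j - 1) I

/-- The coefficient `w_{i₁,…,i_m}(α₁, …, α_k)` for the multi-index `I = [i₁, …, i_m]`. -/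
def w (α : ℕ → ℝ) (k : ℕ) (I : List ℕ) : ℝ :=
  wRev α k I.reverse

/-- `ε_{i₁,…,i_m} = 1/m!` if all entries are `1`, and `0` otherwise. -/
def epsilon (I : List ℕ) : ℝ :=
  if ∀ i ∈ I, i = 1 then 1 / (I.length.factorial : ℝ) else 0

/-- The coefficient `v_{i₁,…,i_m}(α₁, …, α_s)` for the multi-index `I = [i₁, …, i_m]`, `m ≥ 1`. -/
def v (α : ℕ → ℝ) (s : ℕ) (I : List ℕ) : ℝ :=
  w α s I + (-1 / 2 : ℝ) ^ I.sum * epsilon I +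
    ∑ j ∈ Finset.Ico 1 I.length,
      (-1 / 2 : ℝ) ^ (I.take j).sum * epsilon (I.take j) * w α s (I.drop j)

/-- `d_n^{sym}(α₁, …, α_s)`. For odd `n` it is twice the sum of
`|v_{i₁,…,i_m}(α₁, …, α_s)| / (i₁! ⋯ i_m!)` over all `m ≥ 1` and all positive integers
`i₁, …, i_m` with `i₁ + ⋯ + i_m = n`; for even `n` it is `0`. -/
def dSym (α : ℕ → ℝ) (s n : ℕ) : ℝ :=
  if Odd n then
    2 * ∑ c : Composition n, |v α s c.blocks| / ((c.blocks.map Nat.factorial).prod : ℝ)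
  else 0

/-- The tuple `(γ₁/2, γ₁/2, γ₂/2, γ₂/2, …)` for which the alternating composition of `χ` and `χ*`
is the composition of Strang splittings with coefficients `γ`. -/
def strangCoeff (γ : ℕ → ℝ) (i : ℕ) : ℝ :=
  γ ((i + 1) / 2) / 2

end SplittingError

end

/-!
Write `χ(h) = ∑ hⁿ Xₙ`, so that `X₁ = A₁ + ⋯ + A_N`, and let `U(h) = ⋯ χ(α₂ h) χ*(α₁ h)` be the
composition of the first `s` factors. Since `χ*(h) = χ(-h)⁻¹`, the palindromic scheme is
`Ψ(h) = U(-h)⁻¹ U(h)`. Put `F(h) = U(h) e^{-h X₁ / 2}`. Then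
`Ψ(h) - e^{h X₁} = U(-h)⁻¹ (F(h) - F(-h)) e^{h X₁ / 2}`, and the outer factors are products of
exponentials of skew-adjoint operators, so they and their inverses have norm at most `1`. Hence the
error is at most `‖F(h) - F(-h)‖`, and the order condition says that `F(h) - F(-h) = O(h^{p+1})`
(`norm_composition_sub_expTime_le`).

Only the odd Taylor coefficients of `F` enter `F(h) - F(-h)`, and by the order condition only those
of degree above `p` (`HasTaylor.norm_sub_neg_le`). By telescoping, the coefficients of `U` are the
sums of the words `X_{i_m} ⋯ X_{i₁}` weighted by `w`, and those of `F` are the same sums weighted by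
`v` (`coeff_compositionSeries_mul`). Since `‖Xᵢ‖ ≤ (∑ a_j)^i / i!`, this gives the terms
`d_n^{sym} λⁿ`.

The remainder is controlled by the fact that the bounds `‖P_n‖ ≤ Lⁿ / n!` for the coefficients and
`(|h| L)^q / q!` for all Taylor remainders are inherited by products, with the constants `L` added
(`HasTaylor.mul`), and hold for the exponential of a skew-adjoint operator of norm at most `L`
(`hasTaylor_expTime`). For `F` the total constant is `(∑ |αᵢ| + 1/2) ∑ a_j`.

Compositions of Strang splittings are the palindromic schemes with the pairs `γᵢ/2, γᵢ/2` as
coefficients.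
-/

noncomputable section

namespace SplittingError

/-! ### Taylor expansions with sharp remainder bounds -/

section Taylor

variable {𝕜 R : Type*} [RCLike 𝕜] [NormedRing R] [NormedAlgebra 𝕜 R]

lemma norm_ofReal_pow_smul (h : ℝ) (n : ℕ) (x : R) :
    ‖(h : 𝕜) ^ n • x‖ = |h| ^ n * ‖x‖ := by
  rw [norm_smul, norm_pow, RCLike.norm_ofReal]

/-- The binomial theorem for divided powers, with the top term split off. -/
lemma add_pow_div_factorial_eq (x y : ℝ) (q : ℕ) :
    (x + y) ^ q / q.factorial =
      x ^ q / q.factorial +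
        ∑ i ∈ Finset.range q, x ^ i / i.factorial * (y ^ (q - i) / (q - i).factorial) := by
  have key : (x + y) ^ q / q.factorial =
      ∑ i ∈ Finset.range (q + 1), x ^ i / i.factorial * (y ^ (q - i) / (q - i).factorial) := by
    rw [add_pow, Finset.sum_div]
    refine Finset.sum_congr rfl fun i hi => ?_
    rw [Nat.cast_choose ℝ (Finset.mem_range_succ_iff.mp hi)]
    have h1 : (q.factorial : ℝ) ≠ 0 := by positivity
    field_simp
  rw [key, Finset.sum_range_succ, add_comm]
  simp

variable (𝕜) in
/-- `g(h)` has the formal power series `P` as its Taylor expansion at `h = 0`, and coefficients and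
remainders are dominated by those of `e^{|h| L}` and by the terms `(|h| L)^q / q!`, as is the case
for a product of exponentials of skew-adjoint operators of total norm `L`.
The case `q = 0` of the remainder bound says that `‖g h‖ ≤ 1`. -/
def HasTaylor (g : ℝ → R) (P : PowerSeries R) (L : ℝ) : Prop :=
  (∀ n, ‖PowerSeries.coeff n P‖ ≤ L ^ n / n.factorial) ∧
    ∀ (q : ℕ) (h : ℝ), ‖g h - ∑ n ∈ Finset.range q, (h : 𝕜) ^ n • PowerSeries.coeff n P‖ ≤
      (|h| * L) ^ q / q.factorial

namespace HasTaylor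

variable {g g₁ g₂ : ℝ → R} {P P₁ P₂ : PowerSeries R} {L L₁ L₂ : ℝ}

lemma norm_le_one (H : HasTaylor 𝕜 g P L) (h : ℝ) : ‖g h‖ ≤ 1 := by
  simpa using H.2 0 h

lemma nonneg (H : HasTaylor 𝕜 g P L) : 0 ≤ L := by
  simpa using (norm_nonneg _).trans (H.1 1)

lemma one (h1 : ‖(1 : R)‖ ≤ 1) : HasTaylor 𝕜 (fun _ => (1 : R)) 1 0 := by
  refine ⟨fun n => ?_, fun q h => ?_⟩
  · rcases n with _ | n <;> simp [PowerSeries.coeff_one, h1]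
  · rcases q with _ | q
    · simpa using h1
    · rw [Finset.sum_eq_single 0] <;> simp +contextual [PowerSeries.coeff_one]

/-- The multiplicative structure of the remainder bounds: since `g₂` is bounded by `1`, the
binomial theorem adds up the bounds for the factors to the bound for the product. -/
lemma mul (H₁ : HasTaylor 𝕜 g₁ P₁ L₁) (H₂ : HasTaylor 𝕜 g₂ P₂ L₂) :
    HasTaylor 𝕜 (fun h => g₁ h * g₂ h) (P₁ * P₂) (L₁ + L₂) := by
  have hL₁ := H₁.nonneg
  have hL₂ := H₂.nonneg
  refine ⟨fun n => ?_, fun q h => ?_⟩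
  · have : (L₁ + L₂) ^ n / n.factorial = ∑ i ∈ Finset.range (n + 1),
        L₁ ^ i / i.factorial * (L₂ ^ (n - i) / (n - i).factorial) := by
      rw [add_pow_div_factorial_eq, Finset.sum_range_succ, add_comm]
      simp
    rw [this, PowerSeries.coeff_mul, Finset.Nat.sum_antidiagonal_eq_sum_range_succ_mk]
    refine (norm_sum_le _ _).trans (Finset.sum_le_sum fun i _ => (norm_mul_le _ _).trans ?_)
    gcongr
    · exact H₁.1 i
    · exact H₂.1 (n - i)
  · have split : g₁ h * g₂ h -
        ∑ n ∈ Finset.range q, (h : 𝕜) ^ n • PowerSeries.coeff n (P₁ * P₂) =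
        (g₁ h - ∑ n ∈ Finset.range q, (h : 𝕜) ^ n • PowerSeries.coeff n P₁) * g₂ h +
        ∑ i ∈ Finset.range q, ((h : 𝕜) ^ i • PowerSeries.coeff i P₁) *
          (g₂ h - ∑ n ∈ Finset.range (q - i), (h : 𝕜) ^ n • PowerSeries.coeff n P₂) := by
      have : ∑ n ∈ Finset.range q, (h : 𝕜) ^ n • PowerSeries.coeff n (P₁ * P₂) =
          ∑ i ∈ Finset.range q, ((h : 𝕜) ^ i • PowerSeries.coeff i P₁) *
            ∑ n ∈ Finset.range (q - i), (h : 𝕜) ^ n • PowerSeries.coeff n P₂ := by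
        simp only [Finset.mul_sum]
        rw [← Finset.sum_range_diag_flip]
        refine Finset.sum_congr rfl fun n _ => ?_
        rw [PowerSeries.coeff_mul, Finset.Nat.sum_antidiagonal_eq_sum_range_succ_mk,
          Finset.smul_sum]
        refine Finset.sum_congr rfl fun i hi => ?_
        rw [smul_mul_smul_comm, ← pow_add, Nat.add_sub_cancel' (Finset.mem_range_succ_iff.mp hi)]
      rw [this]
      simp only [mul_sub, sub_mul, Finset.sum_sub_distrib, Finset.sum_mul]
      abel
    rw [split, mul_add, add_pow_div_factorial_eq]
    refine (norm_add_le _ _).trans (add_le_add ?_ ?_)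
    · refine (norm_mul_le _ _).trans ?_
      have := mul_le_mul (H₁.2 q h) (H₂.norm_le_one h) (norm_nonneg _)
        (by positivity)
      simpa using this
    · refine (norm_sum_le _ _).trans (Finset.sum_le_sum fun i _ => (norm_mul_le _ _).trans ?_)
      gcongr
      · rw [norm_ofReal_pow_smul, mul_pow, mul_div_assoc]
        gcongr
        exact H₁.1 i
      · exact H₂.2 (q - i) h

lemma list_prod {ι : Type*} (h1 : ‖(1 : R)‖ ≤ 1) (g : ι → ℝ → R) (P : ι → PowerSeries R)
    (L : ι → ℝ) (H : ∀ i, HasTaylor 𝕜 (g i) (P i) (L i)) (l : List ι) :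
    HasTaylor 𝕜 (fun h => (l.map fun i => g i h).prod) (l.map P).prod (l.map L).sum := by
  induction l with
  | nil => simpa using one h1
  | cons i l ih => simpa using (H i).mul ih

end HasTaylor

variable (𝕜) in
/-- The power series `P(c t)`. (`PowerSeries.rescale` is only available over commutative rings.) -/
def scale (c : ℝ) (P : PowerSeries R) : PowerSeries R :=
  PowerSeries.mk fun n => (c : 𝕜) ^ n • PowerSeries.coeff n P

@[simp]
lemma coeff_scale (c : ℝ) (P : PowerSeries R) (n : ℕ) :
    PowerSeries.coeff n (scale 𝕜 c P) = (c : 𝕜) ^ n • PowerSeries.coeff n P :=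
  PowerSeries.coeff_mk _ _

lemma HasTaylor.scale {g : ℝ → R} {P : PowerSeries R} {L : ℝ} (H : HasTaylor 𝕜 g P L) (c : ℝ) :
    HasTaylor 𝕜 (fun h => g (c * h)) (scale 𝕜 c P) (|c| * L) := by
  refine ⟨fun n => ?_, fun q h => ?_⟩
  · rw [coeff_scale, norm_ofReal_pow_smul, mul_pow, mul_div_assoc]
    gcongr
    exact H.1 n
  · have := H.2 q (c * h)
    simp only [coeff_scale, smul_smul, ← mul_pow]
    simpa [abs_mul, mul_comm, mul_assoc, mul_left_comm] using this

/-- A polynomial in `h` of degree less than `q` which is `O(h^q)` vanishes. -/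
lemma coeff_eq_zero_of_isBigO (c : ℕ → R) (q : ℕ)
    (H : (fun h : ℝ => ∑ n ∈ Finset.range q, (h : 𝕜) ^ n • c n) =O[𝓝 0] fun h : ℝ => h ^ q)
    (n : ℕ) (hn : n < q) : c n = 0 := by
  induction n using Nat.strong_induction_on with
  | _ n ih =>
  -- All terms of degree at least `n + 1` are `O(h^{n+1})`, and so is the single remaining one.
  have mono : ∀ k, n + 1 ≤ k → (fun h : ℝ => h ^ k) =O[𝓝 0] fun h : ℝ => h ^ (n + 1) := by
    intro k hk
    have : (fun h : ℝ => h ^ k) = fun h => h ^ (n + 1) * h ^ (k - (n + 1)) := by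
      funext h
      rw [← pow_add, Nat.add_sub_cancel' hk]
    rw [this]
    have h2 : (fun h : ℝ => h ^ (k - (n + 1))) =O[𝓝 0] fun _ => (1 : ℝ) :=
      (continuous_pow (k - (n + 1))).continuousAt.isBigO_one ℝ
    simpa using (isBigO_refl (fun h : ℝ => h ^ (n + 1)) (𝓝 0)).mul h2
  have high : (fun h : ℝ => ∑ k ∈ Finset.Ico (n + 1) q, (h : 𝕜) ^ k • c k) =O[𝓝 0]
      fun h : ℝ => h ^ (n + 1) := by
    refine IsBigO.fun_sum fun k hk => ?_
    refine IsBigO.trans (g := fun h : ℝ => h ^ k) ?_ (mono k (Finset.mem_Ico.mp hk).1)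
    refine IsBigO.of_bound ‖c k‖ (Filter.Eventually.of_forall fun h => ?_)
    rw [norm_ofReal_pow_smul, norm_pow, Real.norm_eq_abs, mul_comm]
  have low : (fun h : ℝ => (h : 𝕜) ^ n • c n) =O[𝓝 0] fun h : ℝ => h ^ (n + 1) := by
    refine ((H.trans (mono q hn)).sub high).congr_left fun h => ?_
    rw [← Finset.sum_range_add_sum_Ico _ (show n + 1 ≤ q from hn), add_sub_cancel_right,
      Finset.sum_range_succ, Finset.sum_eq_zero, zero_add]
    intro k hk
    have hk := Finset.mem_range.mp hk
    rw [ih k hk (hk.trans hn), smul_zero]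
  obtain ⟨C, hC⟩ := low.bound
  have lim : Filter.Tendsto (fun h : ℝ => C * |h|) (𝓝[≠] 0) (𝓝 0) := by
    have : Continuous fun h : ℝ => C * |h| := by fun_prop
    simpa using (this.tendsto 0).mono_left nhdsWithin_le_nhds
  have le : ∀ᶠ h : ℝ in 𝓝[≠] 0, ‖c n‖ ≤ C * |h| := by
    filter_upwards [nhdsWithin_le_nhds hC, self_mem_nhdsWithin] with h hh h0
    have h0 : 0 < |h| ^ n := pow_pos (abs_pos.mpr h0) n
    rw [norm_ofReal_pow_smul, norm_pow, Real.norm_eq_abs, pow_succ] at hh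
    exact le_of_mul_le_mul_left (by linarith) h0
  simpa using ge_of_tendsto lim le

namespace HasTaylor

lemma isBigO {g : ℝ → R} {P : PowerSeries R} {L : ℝ} (H : HasTaylor 𝕜 g P L) (q : ℕ) :
    (fun h : ℝ => g h - ∑ n ∈ Finset.range q, (h : 𝕜) ^ n • PowerSeries.coeff n P) =O[𝓝 0]
      fun h : ℝ => h ^ q := by
  refine IsBigO.of_bound (L ^ q / q.factorial) (Filter.Eventually.of_forall fun h => ?_)
  refine (H.2 q h).trans_eq ?_
  rw [norm_pow, Real.norm_eq_abs]
  ring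

lemma unique {g : ℝ → R} {P₁ P₂ : PowerSeries R} {L₁ L₂ : ℝ} (H₁ : HasTaylor 𝕜 g P₁ L₁)
    (H₂ : HasTaylor 𝕜 g P₂ L₂) : P₁ = P₂ := by
  ext n
  rw [← sub_eq_zero]
  refine coeff_eq_zero_of_isBigO (𝕜 := 𝕜)
    (fun n => PowerSeries.coeff n P₁ - PowerSeries.coeff n P₂) (n + 1) ?_ n n.lt_succ_self
  refine ((H₂.isBigO (n + 1)).sub (H₁.isBigO (n + 1))).congr_left fun h => ?_
  simp only [smul_sub, Finset.sum_sub_distrib]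
  abel

/-- The difference `g(h) - g(-h)` only sees the odd Taylor coefficients. If it is `O(h^{p+1})`, those
of degree at most `p` vanish and do not contribute to the error. -/
lemma norm_sub_neg_le {g : ℝ → R} {P : PowerSeries R} {L : ℝ} (H : HasTaylor 𝕜 g P L) {p q : ℕ}
    (hpq : p ≤ q) (ho : (fun h : ℝ => g h - g (-h)) =O[𝓝 0] fun h : ℝ => h ^ (p + 1)) (h : ℝ) :
    ‖g h - g (-h)‖ ≤
      ∑ n ∈ Finset.Icc (p + 1) q,
        (if Odd n then 2 * ‖PowerSeries.coeff n P‖ else 0) * |h| ^ n +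
      2 * ((|h| * L) ^ (q + 1) / (q + 1).factorial) := by
  -- Degree by degree, this is the Taylor polynomial of `g(h) - g(-h)`.
  let c : ℕ → R := fun n => if Odd n then (2 : 𝕜) • PowerSeries.coeff n P else 0
  have poly : ∀ (q : ℕ) (h : ℝ), ∑ n ∈ Finset.range q, (h : 𝕜) ^ n • c n =
      ∑ n ∈ Finset.range q, (h : 𝕜) ^ n • PowerSeries.coeff n P -
        ∑ n ∈ Finset.range q, ((-h : ℝ) : 𝕜) ^ n • PowerSeries.coeff n P := by
    intro q h
    rw [← Finset.sum_sub_distrib]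
    refine Finset.sum_congr rfl fun n _ => ?_
    rcases Nat.even_or_odd n with hn | hn
    · have : ¬ Odd n := Nat.not_odd_iff_even.mpr hn
      simp [c, this, hn.neg_pow]
    · simp only [c, hn, if_true, RCLike.ofReal_neg, hn.neg_pow, neg_smul, sub_neg_eq_add, two_smul,
        smul_add]
  have zero : ∀ n < p + 1, c n = 0 := by
    refine coeff_eq_zero_of_isBigO (𝕜 := 𝕜) c (p + 1) ?_
    have h1 := H.isBigO (p + 1)
    have h2 : (fun h : ℝ => g (-h) -
        ∑ n ∈ Finset.range (p + 1), ((-h : ℝ) : 𝕜) ^ n • PowerSeries.coeff n P) =O[𝓝 0]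
        fun h : ℝ => h ^ (p + 1) := by
      have ht : Filter.Tendsto (fun h : ℝ => -h) (𝓝 0) (𝓝 0) := by
        simpa using (continuous_neg.tendsto (0 : ℝ))
      refine (h1.comp_tendsto ht).trans (IsBigO.of_bound 1 (Filter.Eventually.of_forall fun h => ?_))
      simp
    refine (ho.sub (h1.sub h2)).congr_left fun h => ?_
    rw [poly]
    abel
  have rem := norm_sub_le
    (g h - ∑ n ∈ Finset.range (q + 1), (h : 𝕜) ^ n • PowerSeries.coeff n P)
    (g (-h) - ∑ n ∈ Finset.range (q + 1), ((-h : ℝ) : 𝕜) ^ n • PowerSeries.coeff n P)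
  have r1 := H.2 (q + 1) h
  have r2 := H.2 (q + 1) (-h)
  rw [abs_neg] at r2
  have decomp : g h - g (-h) = ∑ n ∈ Finset.Icc (p + 1) q, (h : 𝕜) ^ n • c n +
      ((g h - ∑ n ∈ Finset.range (q + 1), (h : 𝕜) ^ n • PowerSeries.coeff n P) -
      (g (-h) - ∑ n ∈ Finset.range (q + 1), ((-h : ℝ) : 𝕜) ^ n • PowerSeries.coeff n P)) := by
    have e : ∑ n ∈ Finset.Icc (p + 1) q, (h : 𝕜) ^ n • c n =
        ∑ n ∈ Finset.range (q + 1), (h : 𝕜) ^ n • c n := by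
      have low : ∑ n ∈ Finset.range (p + 1), (h : 𝕜) ^ n • c n = 0 :=
        Finset.sum_eq_zero fun n hn => by rw [zero n (Finset.mem_range.mp hn), smul_zero]
      rw [← Finset.sum_range_add_sum_Ico _ (Nat.succ_le_succ hpq), Nat.succ_eq_add_one, low,
        zero_add]
      rfl
    rw [e, poly]
    abel
  rw [decomp]
  refine (norm_add_le _ _).trans (add_le_add ?_ (by linarith))
  refine (norm_sum_le _ _).trans (Finset.sum_le_sum fun n _ => ?_)
  rw [norm_ofReal_pow_smul, mul_comm]
  gcongr
  by_cases hn : Odd n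
  · simp only [c, hn, if_true, norm_smul]
    simp
  · simp [c, hn]

end HasTaylor

end Taylor

/-! ### Sums over compositions -/

lemma sum_composition_zero {M : Type*} [AddCommMonoid M] (f : List ℕ → M) :
    ∑ c : Composition 0, f c.blocks = f [] := by
  rw [Fintype.sum_eq_single (Composition.ones 0)]
  · simp
  · intro c hc
    exact absurd (Composition.ext (by simp [Composition.blocks_eq_nil])) hc

/-- Splitting a sum over compositions according to the first block. -/
lemma sum_composition_succ {M : Type*} [AddCommMonoid M] (n : ℕ) (f : List ℕ → M) :
    ∑ c : Composition (n + 1), f c.blocks =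
      ∑ i ∈ Finset.range (n + 1), ∑ c : Composition (n - i), f ((i + 1) :: c.blocks) := by
  rw [Finset.sum_range fun i => ∑ c : Composition (n - i), f ((i + 1) :: c.blocks),
    ← Fintype.sum_sigma' fun (i : Fin (n + 1)) (c : Composition (n - i)) =>
      f ((i + 1) :: c.blocks)]
  symm
  refine Fintype.sum_bijective
    (fun x : Σ i : Fin (n + 1), Composition (n - i) =>
      (⟨(x.1 + 1) :: x.2.blocks, ?_, ?_⟩ : Composition (n + 1))) ⟨?_, ?_⟩ _ _ fun x => rfl
  · intro i hi
    rcases List.mem_cons.mp hi with rfl | hi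
    · omega
    · exact x.2.blocks_pos hi
  · have := x.1.2
    rw [List.sum_cons, x.2.blocks_sum]
    omega
  · rintro ⟨⟨i, hi⟩, c⟩ ⟨⟨j, hj⟩, d⟩ h
    simp only [Composition.mk.injEq, List.cons.injEq, Nat.add_right_cancel_iff] at h
    obtain ⟨rfl, h⟩ := h
    obtain rfl := Composition.ext h
    rfl
  · rintro ⟨l, hl, hs⟩
    rcases l with _ | ⟨i, l⟩
    · simp at hs
    · have hi : 0 < i := hl (by simp)
      rw [List.sum_cons] at hs
      refine ⟨⟨⟨i - 1, by omega⟩, ⟨l, fun h => hl (by simp [h]), ?_⟩⟩, ?_⟩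
      · dsimp only
        omega
      · ext1
        dsimp only
        rw [Nat.sub_add_cancel hi]

lemma sum_composition_reverse {M : Type*} [AddCommMonoid M] (n : ℕ) (f : List ℕ → M) :
    ∑ c : Composition n, f c.blocks.reverse = ∑ c : Composition n, f c.blocks :=
  Fintype.sum_bijective Composition.reverse Composition.reverse_bijective _ _ fun _ => rfl

/-! ### The coefficients `w` and `v` -/

/-- `(-1/2)^{i₁+⋯+i_m} ε_{i₁,…,i_m}`, the coefficient of `X_{i_m} ⋯ X_{i₁}` in `e^{-X₁/2}`. -/
def halfExpCoeff (I : List ℕ) : ℝ :=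
  (-1 / 2 : ℝ) ^ I.sum * epsilon I

lemma halfExpCoeff_nil : halfExpCoeff [] = 1 := by
  simp [halfExpCoeff, epsilon]

lemma halfExpCoeff_reverse (I : List ℕ) : halfExpCoeff I.reverse = halfExpCoeff I := by
  simp [halfExpCoeff, epsilon]

lemma wRev_nil (α : ℕ → ℝ) (k : ℕ) : wRev α k [] = 1 := by
  rw [wRev]

/-- The coefficients `v` with the multi-index listed from its last entry, like `wRev`; the empty
multi-index gets the coefficient `1`. -/
def vRev (α : ℕ → ℝ) (k : ℕ) (J : List ℕ) : ℝ :=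
  ∑ j ∈ Finset.range (J.length + 1), halfExpCoeff (J.drop j) * wRev α k (J.take j)

lemma vRev_nil (α : ℕ → ℝ) (k : ℕ) : vRev α k [] = 1 := by
  simp [vRev, halfExpCoeff_nil, wRev_nil]

/-- The coefficients `v` satisfy the recursion of the coefficients `w`, with a source term. -/
lemma vRev_cons (α : ℕ → ℝ) (k i : ℕ) (J : List ℕ) :
    vRev α k (i :: J) = halfExpCoeff (i :: J) +
      ∑ j ∈ Finset.Icc 1 ((k + 1) / 2),
        ((if 2 * j ≤ k then α (2 * j) else 0) ^ i - (-α (2 * j - 1)) ^ i) *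
          vRev α (2 * j - 1) J := by
  rw [vRev, List.length_cons, Finset.sum_range_succ', add_comm]
  congr 1
  · simp [wRev_nil]
  · simp only [List.drop_succ_cons, List.take_succ_cons, wRev, vRev, Finset.mul_sum]
    rw [Finset.sum_comm]
    exact Finset.sum_congr rfl fun j _ => Finset.sum_congr rfl fun l _ => by ring

lemma v_eq_vRev (α : ℕ → ℝ) (s : ℕ) (I : List ℕ) (hI : I ≠ []) :
    v α s I = vRev α s I.reverse := by
  have hl : 0 < I.length := List.length_pos_iff.mpr hI
  have key : vRev α s I.reverse =
      ∑ j ∈ Finset.range (I.length + 1), halfExpCoeff (I.take j) * w α s (I.drop j) := by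
    rw [vRev, List.length_reverse, ← Finset.sum_range_reflect]
    refine Finset.sum_congr rfl fun j hj => ?_
    have hj := Finset.mem_range_succ_iff.mp hj
    have e : I.length + 1 - 1 - j = I.length - j := by omega
    rw [e, List.drop_reverse, List.take_reverse, halfExpCoeff_reverse, w, Nat.sub_sub_self hj]
  rw [key, Finset.sum_range_succ, Finset.range_eq_Ico, Finset.sum_eq_sum_Ico_succ_bot hl, v]
  simp only [List.take_zero, List.drop_zero, List.take_length, List.drop_length, halfExpCoeff_nil,
    w, List.reverse_nil, wRev_nil]
  simp only [halfExpCoeff]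
  ring

/-! ### The formal power series of the scheme -/

section Formal

variable {𝕜 R : Type*} [RCLike 𝕜] [NormedRing R] [NormedAlgebra 𝕜 R]

variable (𝕜) in
/-- The formal power series of the alternating composition, in terms of the series `X` of `χ` and
`Y` of `χ*`. -/
def compositionSeries (X Y : PowerSeries R) (α : ℕ → ℝ) : ℕ → PowerSeries R
  | 0 => 1
  | k + 1 =>
    (if Even (k + 1) then scale 𝕜 (α (k + 1)) X else scale 𝕜 (α (k + 1)) Y) *
      compositionSeries X Y α k

lemma scale_zero {X : PowerSeries R} (h0 : PowerSeries.coeff 0 X = 1) : scale 𝕜 0 X = 1 := by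
  ext n
  rcases n with _ | n <;> simp [h0, PowerSeries.coeff_one]

/-- The telescoping identity behind the recursion for `w`: since `χ*(α h) = χ(-α h)⁻¹`, multiplying
by a pair of factors adds `(χ(α_{2j} h) - χ(-α_{2j-1} h))` times the composition of the first
`2j - 1` factors. -/
lemma compositionSeries_eq {X Y : PowerSeries R} (h0 : PowerSeries.coeff 0 X = 1)
    (hXY : ∀ c : ℝ, scale 𝕜 (-c) X * scale 𝕜 c Y = 1) (α : ℕ → ℝ) (k : ℕ) :
    compositionSeries 𝕜 X Y α k = 1 + ∑ j ∈ Finset.Icc 1 ((k + 1) / 2),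
      (scale 𝕜 (if 2 * j ≤ k then α (2 * j) else 0) X - scale 𝕜 (-α (2 * j - 1)) X) *
        compositionSeries 𝕜 X Y α (2 * j - 1) := by
  have inv : ∀ l, scale 𝕜 (-α (2 * l + 1)) X * compositionSeries 𝕜 X Y α (2 * l + 1) =
      compositionSeries 𝕜 X Y α (2 * l) := by
    intro l
    have : ¬ Even (2 * l + 1) := by simp
    rw [compositionSeries, if_neg this, ← mul_assoc, hXY, one_mul]
  have even : ∀ l, compositionSeries 𝕜 X Y α (2 * l) = 1 + ∑ j ∈ Finset.Icc 1 l,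
      (scale 𝕜 (α (2 * j)) X - scale 𝕜 (-α (2 * j - 1)) X) *
        compositionSeries 𝕜 X Y α (2 * j - 1) := by
    intro l
    induction l with
    | zero => simp [compositionSeries]
    | succ l ih =>
      have e : 2 * (l + 1) = 2 * l + 1 + 1 := by ring
      have ev : Even (2 * l + 1 + 1) := ⟨l + 1, by ring⟩
      rw [Finset.sum_Icc_succ_top (by omega), ← add_assoc, ← ih, e, Nat.add_sub_cancel, sub_mul,
        inv, add_sub_cancel]
      conv_lhs => rw [compositionSeries, if_pos ev]
  rcases Nat.even_or_odd' k with ⟨l, rfl | rfl⟩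
  · rw [even, show (2 * l + 1) / 2 = l by omega]
    congr 1
    refine Finset.sum_congr rfl fun j hj => ?_
    rw [if_pos (by have := (Finset.mem_Icc.mp hj).2; omega)]
  · rw [show (2 * l + 1 + 1) / 2 = l + 1 by omega, Finset.sum_Icc_succ_top (by omega),
      if_neg (by omega), scale_zero h0, show 2 * (l + 1) - 1 = 2 * l + 1 by omega, sub_mul, one_mul,
      inv, ← add_assoc]
    have : ∑ j ∈ Finset.Icc 1 l,
        (scale 𝕜 (if 2 * j ≤ 2 * l + 1 then α (2 * j) else 0) X - scale 𝕜 (-α (2 * j - 1)) X) *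
          compositionSeries 𝕜 X Y α (2 * j - 1) = ∑ j ∈ Finset.Icc 1 l,
        (scale 𝕜 (α (2 * j)) X - scale 𝕜 (-α (2 * j - 1)) X) *
          compositionSeries 𝕜 X Y α (2 * j - 1) := by
      refine Finset.sum_congr rfl fun j hj => ?_
      rw [if_pos (by have := (Finset.mem_Icc.mp hj).2; omega)]
    rw [this, ← even]
    abel

variable (𝕜) in
/-- The formal power series of `e^{c t B}`. -/
def expSeries (c : ℝ) (B : R) : PowerSeries R :=
  PowerSeries.mk fun n => ((c ^ n / n.factorial : ℝ) : 𝕜) • B ^ n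

lemma coeff_expSeries (c : ℝ) (B : R) (n : ℕ) :
    PowerSeries.coeff n (expSeries 𝕜 c B) = ((c ^ n / n.factorial : ℝ) : 𝕜) • B ^ n :=
  PowerSeries.coeff_mk _ _

/-- Only the composition with all parts equal to `1` contributes to `e^{-t X₁ / 2}`. -/
lemma sum_halfExpCoeff (x : ℕ → R) (n : ℕ) :
    ∑ c : Composition n, ((halfExpCoeff c.blocks : ℝ) : 𝕜) • (c.blocks.map x).prod =
      PowerSeries.coeff n (expSeries 𝕜 (-1 / 2) (x 1)) := by
  rw [Fintype.sum_eq_single (Composition.ones n)]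
  · have h : ∀ i ∈ (Composition.ones n).blocks, i = 1 := Composition.eq_ones_iff.mp rfl
    rw [coeff_expSeries, halfExpCoeff, epsilon, if_pos h]
    simp [div_eq_mul_inv]
  · intro c hc
    have h : ¬ ∀ i ∈ c.blocks, i = 1 := fun h => hc (Composition.eq_ones_iff.mpr h)
    simp [halfExpCoeff, epsilon, h]

/-- The Taylor coefficients of `⋯ χ(α₂ t) χ*(α₁ t) e^{-t X₁ / 2}` are the sums of the words in
the coefficients of `χ` weighted by `v`. -/
lemma coeff_compositionSeries_mul {X Y : PowerSeries R} (h0 : PowerSeries.coeff 0 X = 1)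
    (hXY : ∀ c : ℝ, scale 𝕜 (-c) X * scale 𝕜 c Y = 1) (α : ℕ → ℝ) (n k : ℕ) :
    PowerSeries.coeff n
        (compositionSeries 𝕜 X Y α k * expSeries 𝕜 (-1 / 2) (PowerSeries.coeff 1 X)) =
      ∑ c : Composition n, ((vRev α k c.blocks : ℝ) : 𝕜) •
        (c.blocks.map fun i => PowerSeries.coeff i X).prod := by
  induction n using Nat.strong_induction_on generalizing k with
  | _ n ih =>
  rw [compositionSeries_eq h0 hXY, add_mul, one_mul, Finset.sum_mul]
  simp only [mul_assoc, map_add, map_sum, PowerSeries.coeff_mul _ (_ - _ : PowerSeries R),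
    Finset.Nat.sum_antidiagonal_eq_sum_range_succ_mk]
  rcases n with _ | n
  · rw [sum_composition_zero fun I => ((vRev α k I : ℝ) : 𝕜) •
      (I.map fun i => PowerSeries.coeff i X).prod]
    simp [vRev_nil, coeff_expSeries]
  · rw [← sum_halfExpCoeff (fun i => PowerSeries.coeff i X),
      sum_composition_succ n fun I => ((vRev α k I : ℝ) : 𝕜) •
        (I.map fun i => PowerSeries.coeff i X).prod,
      sum_composition_succ n fun I => ((halfExpCoeff I : ℝ) : 𝕜) •
        (I.map fun i => PowerSeries.coeff i X).prod]
    simp only [vRev_cons, RCLike.ofReal_add, add_smul, Finset.sum_add_distrib]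
    congr 1
    simp only [RCLike.ofReal_sum, Finset.sum_smul]
    rw [← Finset.sum_congr rfl fun i _ => Finset.sum_comm]
    refine Eq.trans ?_ Finset.sum_comm
    refine Finset.sum_congr rfl fun j _ => ?_
    rw [Nat.succ_eq_add_one, Finset.sum_range_succ' _ (n + 1)]
    have z : ∀ a b : ℝ, PowerSeries.coeff 0 (scale 𝕜 a X - scale 𝕜 b X) = 0 := by
      intro a b
      rw [map_sub, coeff_scale, coeff_scale, pow_zero, pow_zero, sub_self]
    rw [z, zero_mul, add_zero]
    refine Finset.sum_congr rfl fun i _ => ?_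
    rw [Nat.add_sub_add_right, ih (n - i) (by omega), Finset.mul_sum]
    refine Finset.sum_congr rfl fun c _ => ?_
    rw [map_sub, coeff_scale, coeff_scale, ← sub_smul, smul_mul_smul_comm, List.map_cons,
      List.prod_cons]
    push_cast
    rfl

end Formal

/-! ### Exponentials of skew-adjoint operators -/

section Exponential

variable {𝕜 R : Type*} [RCLike 𝕜] [NormedRing R] [NormedAlgebra 𝕜 R]

lemma scale_expSeries (c d : ℝ) (B : R) :
    scale 𝕜 c (expSeries 𝕜 d B) = expSeries 𝕜 (c * d) B := by
  ext n
  rw [coeff_scale, coeff_expSeries, coeff_expSeries, smul_smul]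
  congr 1
  push_cast
  ring

/-- The derivative of a Taylor remainder of `e^{uB}` is `B` times the previous remainder. -/
lemma hasDerivAt_exp_sub_sum [CompleteSpace R] (B : R) (q : ℕ) (u : 𝕜) :
    HasDerivAt
      (fun u : 𝕜 => NormedSpace.exp (u • B) -
        ∑ n ∈ Finset.range (q + 1), (u ^ n / (n.factorial : 𝕜)) • B ^ n)
      (B * (NormedSpace.exp (u • B) -
        ∑ n ∈ Finset.range q, (u ^ n / (n.factorial : 𝕜)) • B ^ n)) u := by
  rw [mul_sub]
  refine (hasDerivAt_exp_smul_const' B u).sub ?_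
  simp only [Finset.sum_range_succ' _ q]
  rw [Finset.mul_sum]
  simp only [pow_zero]
  refine HasDerivAt.add_const _ (HasDerivAt.fun_sum fun n _ => ?_)
  have h := (((hasDerivAt_id u).pow (n + 1)).div_const
    ((n + 1).factorial : 𝕜)).smul_const (B ^ (n + 1))
  have e : B * (u ^ n / (n.factorial : 𝕜)) • B ^ n =
      (((n + 1 : ℕ) : 𝕜) * id u ^ (n + 1 - 1) * 1 / ((n + 1).factorial : 𝕜)) • B ^ (n + 1) := by
    rw [mul_smul_comm, ← pow_succ', Nat.factorial_succ, Nat.add_sub_cancel]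
    congr 1
    have h1 : ((n + 1 : ℕ) : 𝕜) ≠ 0 := Nat.cast_ne_zero.mpr n.succ_ne_zero
    have h2 : (n.factorial : 𝕜) ≠ 0 := Nat.cast_ne_zero.mpr n.factorial_ne_zero
    rw [Nat.cast_mul, id]
    field_simp
  rw [e]
  exact h

/-- Integrating the bound `‖e^{tB}‖ ≤ 1` repeatedly gives the sharp remainder bounds. -/
lemma norm_exp_sub_sum_le [CompleteSpace R] (B : R) {L : ℝ} (hB : ‖B‖ ≤ L)
    (h1 : ∀ t : ℝ, 0 ≤ t → ‖NormedSpace.exp ((t : 𝕜) • B)‖ ≤ 1) (q : ℕ) (t : ℝ) (ht : 0 ≤ t) :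
    ‖NormedSpace.exp ((t : 𝕜) • B) -
      ∑ n ∈ Finset.range q, ((t : 𝕜) ^ n / (n.factorial : 𝕜)) • B ^ n‖ ≤
        (t * L) ^ q / q.factorial := by
  let _ : NormedSpace ℝ R := NormedSpace.restrictScalars ℝ 𝕜 R
  have : IsScalarTower ℝ 𝕜 R := ⟨fun a b x => by
    rw [RCLike.real_smul_eq_coe_mul, mul_smul]
    rfl⟩
  induction q generalizing t with
  | zero => simpa using h1 t ht
  | succ q ih =>
    have hd : ∀ x : ℝ, HasDerivAt
        (fun t : ℝ => NormedSpace.exp ((t : 𝕜) • B) -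
          ∑ n ∈ Finset.range (q + 1), ((t : 𝕜) ^ n / (n.factorial : 𝕜)) • B ^ n)
        (B * (NormedSpace.exp ((x : 𝕜) • B) -
          ∑ n ∈ Finset.range q, ((x : 𝕜) ^ n / (n.factorial : 𝕜)) • B ^ n)) x := by
      intro x
      have h := HasDerivAt.scomp x (h := fun t : ℝ => (t : 𝕜)) (h' := (1 : 𝕜))
        (hasDerivAt_exp_sub_sum (𝕜 := 𝕜) B q (x : 𝕜))
        (by simpa using (RCLike.ofRealCLM (K := 𝕜)).hasDerivAt (x := x))
      rw [one_smul] at h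
      exact h
    have hb : ∀ x : ℝ, HasDerivAt (fun t : ℝ => (t * L) ^ (q + 1) / (q + 1).factorial)
        (L * ((x * L) ^ q / q.factorial)) x := by
      intro x
      have h := (((hasDerivAt_id x).mul_const L).pow (q + 1)).div_const ((q + 1).factorial : ℝ)
      have e : L * ((x * L) ^ q / q.factorial) =
          ((q + 1 : ℕ) : ℝ) * (id x * L) ^ (q + 1 - 1) * (1 * L) / ((q + 1).factorial : ℝ) := by
        have h1 : (q.factorial : ℝ) ≠ 0 := by positivity
        rw [Nat.factorial_succ, Nat.add_sub_cancel, id]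
        push_cast
        field_simp
      rw [e]
      exact h
    refine image_norm_le_of_norm_deriv_right_le_deriv_boundary (a := 0) (b := t)
      (fun x _ => (hd x).continuousAt.continuousWithinAt) (fun x _ => (hd x).hasDerivWithinAt)
      ?_ hb (fun x hx => ?_) (Set.right_mem_Icc.mpr ht)
    · simp [Finset.sum_range_succ']
    · refine (norm_mul_le _ _).trans ?_
      have := (norm_nonneg B).trans hB
      gcongr
      exact ih x hx.1

end Exponential

section Operators

variable {𝕜 H : Type*} [RCLike 𝕜] [NormedAddCommGroup H] [InnerProductSpace 𝕜 H]
  [CompleteSpace H]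

lemma expTime_add (B : H →L[𝕜] H) (x y : ℝ) : expTime B (x + y) = expTime B x * expTime B y := by
  let _ : NormedAlgebra ℚ (H →L[𝕜] H) := NormedAlgebra.restrictScalars ℚ 𝕜 (H →L[𝕜] H)
  rw [expTime, RCLike.ofReal_add, add_smul, NormedSpace.exp_add_of_commute]
  · rfl
  · exact ((Commute.refl B).smul_left _).smul_right _

lemma expTime_mul_neg (B : H →L[𝕜] H) (x : ℝ) : expTime B x * expTime B (-x) = 1 := by
  rw [← expTime_add, add_neg_cancel]
  simp [expTime]

lemma norm_expTime_le_one {B : H →L[𝕜] H} (hB : ContinuousLinearMap.adjoint B = -B) (t : ℝ) :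
    ‖expTime B t‖ ≤ 1 := by
  let _ : NormedAlgebra ℚ (H →L[𝕜] H) := NormedAlgebra.restrictScalars ℚ 𝕜 (H →L[𝕜] H)
  have hs : (t : 𝕜) • B ∈ skewAdjoint (H →L[𝕜] H) := by
    rw [skewAdjoint.mem_iff, star_smul, ContinuousLinearMap.star_eq_adjoint, hB]
    simp
  have hu := NormedSpace.exp_mem_unitary_of_mem_skewAdjoint hs
  rcases subsingleton_or_nontrivial (H →L[𝕜] H) with h | h
  · rw [Subsingleton.elim (expTime B t) 0, norm_zero]
    exact zero_le_one
  · exact (CStarRing.norm_of_mem_unitary hu).le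

lemma hasTaylor_expTime {B : H →L[𝕜] H} (hB : ContinuousLinearMap.adjoint B = -B) {L : ℝ}
    (hL : ‖B‖ ≤ L) : HasTaylor 𝕜 (expTime B) (expSeries 𝕜 1 B) L := by
  refine ⟨fun n => ?_, fun q h => ?_⟩
  · have h1 : ‖B ^ n‖ ≤ L ^ n := by
      rcases n with _ | n
      · simpa [expTime] using norm_expTime_le_one hB 0
      · exact (norm_pow_le' B n.succ_pos).trans (by gcongr)
    rw [coeff_expSeries, norm_smul, RCLike.norm_ofReal, one_pow, abs_of_nonneg (by positivity),
      one_div, inv_mul_eq_div]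
    gcongr
  · have sum_eq : ∀ (C : H →L[𝕜] H) (t : ℝ),
        ∑ n ∈ Finset.range q, ((t : 𝕜) ^ n / (n.factorial : 𝕜)) • C ^ n =
          ∑ n ∈ Finset.range q, (t : 𝕜) ^ n • PowerSeries.coeff n (expSeries 𝕜 1 C) := by
      intro C t
      refine Finset.sum_congr rfl fun n _ => ?_
      rw [coeff_expSeries, smul_smul]
      congr 1
      push_cast
      rw [one_pow, one_div, div_eq_mul_inv]
    rcases le_total 0 h with h0 | h0
    · rw [← sum_eq, abs_of_nonneg h0]
      exact norm_exp_sub_sum_le B hL (fun t _ => norm_expTime_le_one hB t) q h h0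
    · -- For negative times, the estimate is that for `-B`.
      have hB' : ContinuousLinearMap.adjoint (-B) = -(-B) := by rw [map_neg, hB]
      have key := norm_exp_sub_sum_le (𝕜 := 𝕜) (-B) (L := L) (by rwa [norm_neg])
        (fun t _ => norm_expTime_le_one hB' t) q (-h) (by linarith)
      rw [abs_of_nonpos h0]
      refine le_of_eq_of_le (congrArg norm ?_) key
      rw [← sum_eq]
      congr 1
      · rw [expTime, RCLike.ofReal_neg, smul_neg, neg_smul, neg_neg]
      · refine Finset.sum_congr rfl fun n _ => ?_
        rcases Nat.even_or_odd n with hn | hn <;> simp [hn.neg_pow, neg_div]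

end Operators

/-! ### The schemes and their adjoints -/

lemma prod_map_mul_prod_reverse_map {M ι : Type*} [Monoid M] (f g : ι → M)
    (hfg : ∀ i, f i * g i = 1) (l : List ι) :
    (l.map f).prod * (l.map g).reverse.prod = 1 := by
  induction l with
  | nil => simp
  | cons i l ih =>
    rw [List.map_cons, List.map_cons, List.reverse_cons, List.prod_append, List.prod_cons,
      List.prod_singleton, mul_assoc, ← mul_assoc (l.map f).prod, ih, one_mul, hfg]

lemma isPalindromic_strangCoeff {γ : ℕ → ℝ} {s : ℕ} (hγ : IsPalindromic γ s) :
    IsPalindromic (strangCoeff γ) (2 * s) := by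
  intro j h1 h2
  rw [strangCoeff, strangCoeff, show (2 * s + 1 - j + 1) / 2 = s + 1 - (j + 1) / 2 by omega,
    hγ _ (by omega) (by omega)]

/-- Each `|γ_i|` is hit twice by the pairs `γ_i/2, γ_i/2`, of which the first `s` entries are one
half by symmetry. -/
lemma two_mul_sum_abs_strangCoeff {γ : ℕ → ℝ} {s : ℕ} (hγ : IsPalindromic γ s) :
    2 * ∑ i ∈ Finset.Icc 1 s, |strangCoeff γ i| = ∑ i ∈ Finset.Icc 1 s, |γ i| := by
  have hα := isPalindromic_strangCoeff hγ
  have total : ∀ k, ∑ i ∈ Finset.Icc 1 (2 * k), |strangCoeff γ i| =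
      ∑ i ∈ Finset.Icc 1 k, |γ i| := by
    intro k
    induction k with
    | zero => simp
    | succ k ih =>
      rw [show 2 * (k + 1) = 2 * k + 1 + 1 by ring, Finset.sum_Icc_succ_top (by omega),
        Finset.sum_Icc_succ_top (by omega), ih, Finset.sum_Icc_succ_top (by omega), strangCoeff,
        strangCoeff, show (2 * k + 1 + 1) / 2 = k + 1 by omega,
        show (2 * k + 1 + 1 + 1) / 2 = k + 1 by omega, abs_div, abs_two]
      ring
  have half : ∀ m ≤ s, ∑ i ∈ Finset.Icc 1 (2 * s), |strangCoeff γ i| =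
      ∑ i ∈ Finset.Icc 1 m, |strangCoeff γ i| +
        ∑ i ∈ Finset.Icc 1 (2 * s - m), |strangCoeff γ i| := by
    intro m hm
    induction m with
    | zero => simp
    | succ m ih =>
      obtain ⟨k, hk⟩ : ∃ k, 2 * s - m = k + 1 := ⟨2 * s - m - 1, by omega⟩
      have hp := hα (m + 1) (by omega) (by omega)
      rw [show 2 * s + 1 - (m + 1) = k + 1 by omega] at hp
      rw [ih (by omega), hk, Finset.sum_Icc_succ_top (by omega), Finset.sum_Icc_succ_top (by omega),
        hp, show 2 * s - (m + 1) = k by omega]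
      ring
  rw [← total, half s le_rfl, show 2 * s - s = s by omega]
  ring

section Schemes

variable {𝕜 H : Type*} [RCLike 𝕜] [NormedAddCommGroup H] [InnerProductSpace 𝕜 H] {N : ℕ}
  (A : Fin N → H →L[𝕜] H)

/-- The factors of the alternating composition in reverse order and with `χ` and `χ*` exchanged:
`χ(α₁ h) χ*(α₂ h) ⋯`. This is the inverse of the composition at `-h`. -/
def mirrorComposition (α : ℕ → ℝ) (h : ℝ) : ℕ → H →L[𝕜] H
  | 0 => 1
  | k + 1 =>
    mirrorComposition α h k *
      if Even (k + 1) then chiStar A (α (k + 1) * h) else chi A (α (k + 1) * h)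

/-- A palindromic composition is symmetric: its second half mirrors its first half. -/
lemma composition_two_mul {α : ℕ → ℝ} {s : ℕ} (hα : IsPalindromic α (2 * s)) (h : ℝ) :
    composition A α h (2 * s) = mirrorComposition A α h s * composition A α h s := by
  have key : ∀ m ≤ s, composition A α h (2 * s) =
      mirrorComposition A α h m * composition A α h (2 * s - m) := by
    intro m hm
    induction m with
    | zero => simp [mirrorComposition]
    | succ m ih =>
      obtain ⟨k, hk⟩ : ∃ k, 2 * s - m = k + 1 := ⟨2 * s - m - 1, by omega⟩
      have hp := hα (m + 1) (by omega) (by omega)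
      rw [show 2 * s + 1 - (m + 1) = k + 1 by omega] at hp
      rw [ih (by omega), mirrorComposition, hk, composition, hp, mul_assoc,
        show 2 * s - (m + 1) = k by omega]
      have parity : Even (k + 1) ↔ ¬ Even (m + 1) := by
        rw [← hk, Nat.even_sub (by omega), Nat.even_add_one]
        simp
      by_cases hm' : Even (m + 1)
      · rw [if_pos hm', if_neg (by rw [parity]; exact not_not.mpr hm')]
      · rw [if_neg hm', if_pos (parity.mpr hm')]
  rw [key s le_rfl, show 2 * s - s = s by omega]

lemma strangComposition_eq_composition (γ : ℕ → ℝ) (h : ℝ) (s : ℕ) :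
    strangComposition A γ h s = composition A (strangCoeff γ) h (2 * s) := by
  induction s with
  | zero => rfl
  | succ s ih =>
    have e1 : ¬ Even (2 * s + 1) := by simp
    have e2 : Even (2 * s + 1 + 1) := ⟨s + 1, by ring⟩
    have c1 : strangCoeff γ (2 * s + 1) * h = γ (s + 1) * h / 2 := by
      rw [strangCoeff, show (2 * s + 1 + 1) / 2 = s + 1 by omega]
      ring
    have c2 : strangCoeff γ (2 * s + 1 + 1) * h = γ (s + 1) * h / 2 := by
      rw [strangCoeff, show (2 * s + 1 + 1 + 1) / 2 = s + 1 by omega]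
      ring
    rw [strangComposition, ih, show 2 * (s + 1) = 2 * s + 1 + 1 by ring, composition, composition,
      if_pos e2, if_neg e1, c1, c2, strang, mul_assoc]

variable [CompleteSpace H]

lemma chi_mul_chiStar_neg (x : ℝ) : chi A x * chiStar A (-x) = 1 := by
  rw [chi, chiStar, List.ofFn_eq_map, List.ofFn_eq_map]
  exact prod_map_mul_prod_reverse_map _ _ (fun j => expTime_mul_neg (A j) x) _

lemma chiStar_mul_chi_neg (x : ℝ) : chiStar A x * chi A (-x) = 1 := by
  rw [chi, chiStar, List.ofFn_eq_map, List.ofFn_eq_map, ← List.map_reverse,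
    ← List.reverse_reverse (List.map _ (List.finRange N)), ← List.map_reverse]
  exact prod_map_mul_prod_reverse_map _ _ (fun j => expTime_mul_neg (A j) x) _

lemma mirrorComposition_mul_composition_neg (α : ℕ → ℝ) (h : ℝ) (k : ℕ) :
    mirrorComposition A α h k * composition A α (-h) k = 1 := by
  induction k with
  | zero => simp [mirrorComposition, composition]
  | succ k ih =>
    rw [mirrorComposition, composition, mul_assoc, ← mul_assoc (ite _ _ _), mul_neg]
    split_ifs
    · rw [chiStar_mul_chi_neg, one_mul, ih]
    · rw [chi_mul_chiStar_neg, one_mul, ih]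

lemma composition_neg_mul_mirrorComposition (α : ℕ → ℝ) (h : ℝ) (k : ℕ) :
    composition A α (-h) k * mirrorComposition A α h k = 1 := by
  induction k with
  | zero => simp [mirrorComposition, composition]
  | succ k ih =>
    rw [mirrorComposition, composition, mul_assoc, ← mul_assoc (composition A α (-h) k), ih,
      one_mul, mul_neg]
    split_ifs
    · simpa using chi_mul_chiStar_neg A (-(α (k + 1) * h))
    · simpa using chiStar_mul_chi_neg A (-(α (k + 1) * h))

end Schemes

/-! ### The error of a symmetric composition -/

section Bound

variable {𝕜 H : Type*} [RCLike 𝕜] [NormedAddCommGroup H] [InnerProductSpace 𝕜 H] {N : ℕ}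

/-- The formal power series of `χ`. -/
def chiSeries (A : Fin N → H →L[𝕜] H) : PowerSeries (H →L[𝕜] H) :=
  ((List.finRange N).map fun j => expSeries 𝕜 1 (A j)).prod

/-- The formal power series of `χ*`. -/
def chiStarSeries (A : Fin N → H →L[𝕜] H) : PowerSeries (H →L[𝕜] H) :=
  ((List.finRange N).reverse.map fun j => expSeries 𝕜 1 (A j)).prod

lemma coeff_zero_and_one_prod_expSeries (A : Fin N → H →L[𝕜] H) (l : List (Fin N)) :
    PowerSeries.coeff 0 (l.map fun j => expSeries 𝕜 1 (A j)).prod = 1 ∧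
      PowerSeries.coeff 1 (l.map fun j => expSeries 𝕜 1 (A j)).prod = (l.map A).sum := by
  induction l with
  | nil => simp [PowerSeries.coeff_one]
  | cons j l ih =>
    have h0 : PowerSeries.coeff 0 (expSeries 𝕜 1 (A j)) = 1 := by simp [coeff_expSeries]
    have h1 : PowerSeries.coeff 1 (expSeries 𝕜 1 (A j)) = A j := by simp [coeff_expSeries]
    constructor
    · rw [List.map_cons, List.prod_cons, PowerSeries.coeff_mul, Finset.Nat.antidiagonal_zero,
        Finset.sum_singleton, h0, ih.1, one_mul]
    · rw [List.map_cons, List.prod_cons, PowerSeries.coeff_mul,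
        Finset.Nat.sum_antidiagonal_eq_sum_range_succ_mk, Finset.sum_range_succ,
        Finset.sum_range_one, Nat.sub_zero, Nat.sub_self, h0, h1, ih.1, ih.2, one_mul, mul_one,
        List.map_cons, List.sum_cons, add_comm]

lemma coeff_zero_chiSeries (A : Fin N → H →L[𝕜] H) : PowerSeries.coeff 0 (chiSeries A) = 1 :=
  (coeff_zero_and_one_prod_expSeries A _).1

lemma coeff_one_chiSeries (A : Fin N → H →L[𝕜] H) :
    PowerSeries.coeff 1 (chiSeries A) = ∑ j, A j := by
  rw [Fin.sum_univ_def]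
  exact (coeff_zero_and_one_prod_expSeries A _).2

lemma norm_one_le_one : ‖(1 : H →L[𝕜] H)‖ ≤ 1 :=
  ContinuousLinearMap.norm_id_le

variable [CompleteSpace H] {A : Fin N → H →L[𝕜] H}

lemma hasTaylor_chi (hA : ∀ j, ContinuousLinearMap.adjoint (A j) = -A j) {a : Fin N → ℝ}
    (ha : ∀ j, ‖A j‖ ≤ a j) : HasTaylor 𝕜 (chi A) (chiSeries A) (∑ j, a j) := by
  have h := HasTaylor.list_prod norm_one_le_one (fun j => expTime (A j))
    (fun j => expSeries 𝕜 1 (A j)) a (fun j => hasTaylor_expTime (hA j) (ha j)) (List.finRange N)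
  rw [← Fin.sum_univ_def] at h
  have e : chi A = fun x => ((List.finRange N).map fun j => expTime (A j) x).prod := by
    funext x
    rw [chi, List.ofFn_eq_map]
  rw [e]
  exact h

lemma hasTaylor_chiStar (hA : ∀ j, ContinuousLinearMap.adjoint (A j) = -A j) {a : Fin N → ℝ}
    (ha : ∀ j, ‖A j‖ ≤ a j) : HasTaylor 𝕜 (chiStar A) (chiStarSeries A) (∑ j, a j) := by
  have h := HasTaylor.list_prod norm_one_le_one (fun j => expTime (A j))
    (fun j => expSeries 𝕜 1 (A j)) a (fun j => hasTaylor_expTime (hA j) (ha j))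
    (List.finRange N).reverse
  rw [List.map_reverse (f := a), List.sum_reverse, ← Fin.sum_univ_def] at h
  have e : chiStar A = fun x => ((List.finRange N).reverse.map fun j => expTime (A j) x).prod := by
    funext x
    rw [chiStar, List.ofFn_eq_map, List.map_reverse]
  rw [e]
  exact h

/-- The formal counterpart of `χ(-c h) χ*(c h) = 1`, by uniqueness of Taylor expansions. -/
lemma scale_chiSeries_mul (hA : ∀ j, ContinuousLinearMap.adjoint (A j) = -A j) (c : ℝ) :
    scale 𝕜 (-c) (chiSeries A) * scale 𝕜 c (chiStarSeries A) = 1 := by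
  have h := ((hasTaylor_chi hA fun j => le_rfl).scale (-c)).mul
    ((hasTaylor_chiStar hA fun j => le_rfl).scale c)
  have e : (fun h : ℝ => chi A (-c * h) * chiStar A (c * h)) = fun _ => 1 := by
    funext h
    simpa using chi_mul_chiStar_neg A (-c * h)
  rw [e] at h
  exact h.unique (HasTaylor.one norm_one_le_one)

lemma hasTaylor_composition (hA : ∀ j, ContinuousLinearMap.adjoint (A j) = -A j) {a : Fin N → ℝ}
    (ha : ∀ j, ‖A j‖ ≤ a j) (α : ℕ → ℝ) (k : ℕ) :
    HasTaylor 𝕜 (fun h => composition A α h k)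
      (compositionSeries 𝕜 (chiSeries A) (chiStarSeries A) α k)
      ((∑ i ∈ Finset.Icc 1 k, |α i|) * ∑ j, a j) := by
  induction k with
  | zero => simpa [composition, compositionSeries] using HasTaylor.one norm_one_le_one
  | succ k ih =>
    rw [Finset.sum_Icc_succ_top (by omega), add_mul, add_comm (_ * _)]
    simp only [composition, compositionSeries]
    split_ifs
    · exact ((hasTaylor_chi hA ha).scale _).mul ih
    · exact ((hasTaylor_chiStar hA ha).scale _).mul ih

/-- The left half of the symmetric scheme is a product of exponentials as well. -/
lemma norm_mirrorComposition_le_one (hA : ∀ j, ContinuousLinearMap.adjoint (A j) = -A j)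
    (α : ℕ → ℝ) (h : ℝ) (k : ℕ) : ‖mirrorComposition A α h k‖ ≤ 1 := by
  induction k with
  | zero => exact norm_one_le_one
  | succ k ih =>
    refine (norm_mul_le _ _).trans (mul_le_one₀ ih (norm_nonneg _) ?_)
    split_ifs
    · exact (hasTaylor_chiStar hA fun j => le_rfl).norm_le_one _
    · exact (hasTaylor_chi hA fun j => le_rfl).norm_le_one _

lemma norm_prod_coeff_chiSeries_le (hA : ∀ j, ContinuousLinearMap.adjoint (A j) = -A j)
    {a : Fin N → ℝ} (ha : ∀ j, ‖A j‖ ≤ a j) (I : List ℕ) :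
    ‖(I.map fun i => PowerSeries.coeff i (chiSeries A)).prod‖ ≤
      (∑ j, a j) ^ I.sum / ((I.map Nat.factorial).prod : ℝ) := by
  have hT := hasTaylor_chi hA ha
  induction I with
  | nil => simpa using norm_one_le_one
  | cons i I ih =>
    rw [List.map_cons, List.prod_cons, List.sum_cons, List.map_cons, List.prod_cons, Nat.cast_mul,
      pow_add, mul_div_mul_comm]
    have := hT.nonneg
    exact (norm_mul_le _ _).trans
      (mul_le_mul (hT.1 i) ih (norm_nonneg _) (by positivity))

/-- The Taylor coefficients of odd degree of `⋯ χ(α₂ h) χ*(α₁ h) e^{-h X₁ / 2}` are controlled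
by `d_n^{sym}`. -/
lemma two_mul_norm_coeff_le_dSym (hA : ∀ j, ContinuousLinearMap.adjoint (A j) = -A j)
    {a : Fin N → ℝ} (ha : ∀ j, ‖A j‖ ≤ a j) (α : ℕ → ℝ) (s n : ℕ) :
    (if Odd n then 2 * ‖PowerSeries.coeff n
      (compositionSeries 𝕜 (chiSeries A) (chiStarSeries A) α s *
        expSeries 𝕜 (-1 / 2) (∑ j, A j))‖ else 0) ≤ dSym α s n * (∑ j, a j) ^ n := by
  rw [dSym]
  split_ifs with hn
  · rw [← coeff_one_chiSeries A, coeff_compositionSeries_mul (coeff_zero_chiSeries A)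
      (scale_chiSeries_mul hA), mul_assoc, Finset.sum_mul,
      ← sum_composition_reverse n fun I => ((vRev α s I : ℝ) : 𝕜) •
        (I.map fun i => PowerSeries.coeff i (chiSeries A)).prod]
    refine mul_le_mul_of_nonneg_left ((norm_sum_le _ _).trans (Finset.sum_le_sum fun c _ => ?_))
      zero_le_two
    have hc : c.blocks ≠ [] := by
      rw [Ne, Composition.blocks_eq_nil]
      exact hn.pos.ne'
    have key := norm_prod_coeff_chiSeries_le hA ha c.blocks.reverse
    rw [List.sum_reverse, c.blocks_sum, List.map_reverse (f := Nat.factorial),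
      List.prod_reverse] at key
    rw [v_eq_vRev α s _ hc, norm_smul, RCLike.norm_ofReal, div_mul_eq_mul_div, mul_div_assoc]
    exact mul_le_mul_of_nonneg_left key (abs_nonneg _)
  · simp

lemma adjoint_sum (hA : ∀ j, ContinuousLinearMap.adjoint (A j) = -A j) :
    ContinuousLinearMap.adjoint (∑ j, A j) = -∑ j, A j := by
  rw [map_sum, ← Finset.sum_neg_distrib]
  exact Finset.sum_congr rfl fun j _ => hA j

/-- With `F(h)` the right half of the scheme times `e^{-h X₁ / 2}`, the error of the symmetric scheme
is `F(h) - F(-h)` up to factors of norm at most `1`. -/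
theorem norm_composition_sub_expTime_le (hA : ∀ j, ContinuousLinearMap.adjoint (A j) = -A j)
    {a : Fin N → ℝ} (ha : ∀ j, ‖A j‖ ≤ a j) {p q : ℕ} (hpq : p ≤ q) {s : ℕ} {α : ℕ → ℝ}
    (hα : IsPalindromic α (2 * s)) (ho : HasOrder A (fun h => composition A α h (2 * s)) p)
    (h : ℝ) (hh : 0 ≤ h) :
    ‖composition A α h (2 * s) - expTime (∑ j, A j) h‖ ≤
      ∑ n ∈ Finset.Icc (p + 1) q, dSym α s n * (h * ∑ j, a j) ^ n +
        (h * ∑ j, a j) ^ (q + 1) / ((q + 1).factorial * 2 ^ q) *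
          (1 + 2 * ∑ i ∈ Finset.Icc 1 s, |α i|) ^ (q + 1) := by
  set S := ∑ j, A j
  let F : ℝ → H →L[𝕜] H := fun h => composition A α h s * expTime S (-1 / 2 * h)
  have hE : ∀ t, ‖expTime S t‖ ≤ 1 := norm_expTime_le_one (adjoint_sum hA)
  have hSa : ‖S‖ ≤ ∑ j, a j := (norm_sum_le _ _).trans (Finset.sum_le_sum fun j _ => ha j)
  have hTE := (hasTaylor_expTime (𝕜 := 𝕜) (adjoint_sum hA) hSa).scale (-1 / 2)
  rw [scale_expSeries, mul_one] at hTE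
  have hF := (hasTaylor_composition hA ha α s).mul hTE
  have error : ∀ h, composition A α h (2 * s) - expTime S h =
      mirrorComposition A α h s * (F h - F (-h)) * expTime S (1 / 2 * h) := by
    intro h
    simp only [F]
    rw [composition_two_mul A hα, mul_sub, sub_mul, ← mul_assoc, ← mul_assoc,
      mirrorComposition_mul_composition_neg, one_mul, mul_assoc _ (expTime S _),
      ← expTime_add, ← expTime_add, show -1 / 2 * h + 1 / 2 * h = 0 by ring,
      show -1 / 2 * -h + 1 / 2 * h = h by ring]
    simp [expTime]
  have odd_part : ∀ h, F h - F (-h) = composition A α (-h) s *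
      (composition A α h (2 * s) - expTime S h) * expTime S (-1 / 2 * h) := by
    intro h
    rw [error, ← mul_assoc, ← mul_assoc, composition_neg_mul_mirrorComposition, one_mul, mul_assoc,
      ← expTime_add, show 1 / 2 * h + -1 / 2 * h = 0 by ring]
    simp [expTime]
  have hoF : (fun h => F h - F (-h)) =O[𝓝 0] fun h : ℝ => h ^ (p + 1) := by
    refine IsBigO.trans (IsBigO.of_bound 1 (Filter.Eventually.of_forall fun h => ?_)) ho
    rw [odd_part, one_mul]
    refine (norm_mul_le _ _).trans ((mul_le_of_le_one_right (norm_nonneg _) (hE _)).trans ?_)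
    exact (norm_mul_le _ _).trans (mul_le_of_le_one_left (norm_nonneg _)
      ((hasTaylor_composition hA ha α s).norm_le_one (-h)))
  have bound : ‖composition A α h (2 * s) - expTime S h‖ ≤ ‖F h - F (-h)‖ := by
    rw [error]
    refine (norm_mul_le _ _).trans ((mul_le_of_le_one_right (norm_nonneg _) (hE _)).trans ?_)
    exact (norm_mul_le _ _).trans (mul_le_of_le_one_left (norm_nonneg _)
      (norm_mirrorComposition_le_one hA α h s))
  refine bound.trans ((hF.norm_sub_neg_le hpq hoF h).trans (add_le_add ?_ (le_of_eq ?_)))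
  · refine Finset.sum_le_sum fun n _ => ?_
    rw [abs_of_nonneg hh, mul_pow, mul_left_comm, mul_comm]
    exact mul_le_mul_of_nonneg_left (two_mul_norm_coeff_le_dSym hA ha α s n) (by positivity)
  · have e : |h| * ((∑ i ∈ Finset.Icc 1 s, |α i|) * ∑ j, a j + |(-1 / 2 : ℝ)| * ∑ j, a j) =
        (h * ∑ j, a j) * (1 + 2 * ∑ i ∈ Finset.Icc 1 s, |α i|) / 2 := by
      rw [abs_of_nonneg hh, show |(-1 / 2 : ℝ)| = 1 / 2 by norm_num]
      ring
    rw [e, div_pow, mul_pow _ (1 + _), pow_succ 2 q]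
    field_simp

end Bound

end SplittingError

end

theorem mainTheorem9 {𝕜 H : Type*} [RCLike 𝕜] [NormedAddCommGroup H] [InnerProductSpace 𝕜 H]
    [CompleteSpace H] {N : ℕ} (A : Fin N → H →L[𝕜] H)
    (hA : ∀ j, ContinuousLinearMap.adjoint (A j) = -A j)
    (a : Fin N → ℝ) (ha : ∀ j, ‖A j‖ ≤ a j)
    (p q : ℕ) (hp : Even p) (hpq : p ≤ q) :
    (∀ (s : ℕ) (α : ℕ → ℝ), SplittingError.IsPalindromic α (2 * s) →
      SplittingError.HasOrder A (fun h => SplittingError.composition A α h (2 * s)) p →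
      ∀ h : ℝ, 0 ≤ h →
        ‖SplittingError.composition A α h (2 * s) - SplittingError.expTime (∑ j, A j) h‖ ≤
          ∑ n ∈ Finset.Icc (p + 1) q, SplittingError.dSym α s n * (h * ∑ j, a j) ^ n +
            (h * ∑ j, a j) ^ (q + 1) / ((q + 1).factorial * 2 ^ q) *
              (1 + 2 * ∑ i ∈ Finset.Icc 1 s, |α i|) ^ (q + 1)) ∧
    (∀ (s : ℕ) (γ : ℕ → ℝ), SplittingError.IsPalindromic γ s →
      SplittingError.HasOrder A (fun h => SplittingError.strangComposition A γ h s) p →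
      ∀ h : ℝ, 0 ≤ h →
        ‖SplittingError.strangComposition A γ h s - SplittingError.expTime (∑ j, A j) h‖ ≤
          ∑ n ∈ Finset.Icc (p + 1) q,
              SplittingError.dSym (SplittingError.strangCoeff γ) s n * (h * ∑ j, a j) ^ n +
            (h * ∑ j, a j) ^ (q + 1) / ((q + 1).factorial * 2 ^ q) *
              (1 + ∑ i ∈ Finset.Icc 1 s, |γ i|) ^ (q + 1)) := by
  refine ⟨fun s α hα ho h hh =>
    SplittingError.norm_composition_sub_expTime_le hA ha hpq hα ho h hh, fun s γ hγ ho h hh => ?_⟩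
  simp only [SplittingError.strangComposition_eq_composition] at ho ⊢
  rw [← SplittingError.two_mul_sum_abs_strangCoeff hγ]
  exact SplittingError.norm_composition_sub_expTime_le hA ha hpq
    (SplittingError.isPalindromic_strangCoeff hγ) ho h hh
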